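/- Let $\mathrm{Nil}$ be the group of real matrices $\begin{pmatrix}1&x&z\\0&1&y\\0&0&1\end{pmatrix}$ with the left invariant Riemannian metric $dx^2+dy^2+(dz-x\,dy)^2$, and let $e_1=E_{12}$, $e_2=E_{23}$, $e_3=E_{13}$ (matrix units) be the corresponding orthonormal basis of its Lie algebra. Let $f:M\to\mathrm{Nil}$ be a $C^2$-immersed surface which is minimal (its mean curvature $H$ vanishes identically), and let $w=u+iv$ be a conformal parameter on an open subset of $M$, i.e. the induced metric is $e^{2\alpha}(du^2+dv^2)$ there. Put $\partial=\frac12(\partial_u-i\partial_v)$ and $\bar\partial=\frac12(\partial_u+i\partial_v)$. Let $\psi=(\psi_1,\psi_2)$ be a generating spinor of the surface in this parameter: a pair of continuous complex-valued functions such that $$f^{-1}\partial f=Z_1e_1+Z_2e_2+Z_3e_3,\qquad Z_1=\tfrac i2(\bar\psi_2^2+\psi_1^2),\quad Z_2=\tfrac12(\bar\psi_2^2-\psi_1^2),\quad Z_3=\psi_1\bar\psi_2 .$$ Then $\psi_1,\psi_2$ are (real) differentiable and satisfy $$\bar\partial\psi_1=\frac i4\left(|\psi_2|^2-|\psi_1|^2\right)\psi_2,\qquad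 \partial\psi_2=-\frac i4\left(|\psi_2|^2-|\psi_1|^2\right)\psi_1 .$$ -/

import Mathlib

open scoped Manifold ContDiff

/-! ### The group Nil with its left invariant metric -/

/-- The Heisenberg group `Nil`; the triple `(x, y, z)` stands for the upper unitriangular matrix
`!![1, x, z; 0, 1, y; 0, 0, 1]` (see `NilGroup.toMatrix`). -/
@[ext]
structure NilGroup where
  x : ℝ
  y : ℝ
  z : ℝ

namespace NilGroup

instance : Mul NilGroup := ⟨fun g h => ⟨g.x + h.x, g.y + h.y, g.z + h.z + g.x * h.y⟩⟩
instance : One NilGroup := ⟨⟨0, 0, 0⟩⟩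
instance : Inv NilGroup := ⟨fun g => ⟨-g.x, -g.y, -g.z + g.x * g.y⟩⟩

theorem mul_def (g h : NilGroup) :
    g * h = ⟨g.x + h.x, g.y + h.y, g.z + h.z + g.x * h.y⟩ := rfl

theorem one_def : (1 : NilGroup) = ⟨0, 0, 0⟩ := rfl

theorem inv_def (g : NilGroup) : g⁻¹ = ⟨-g.x, -g.y, -g.z + g.x * g.y⟩ := rfl

instance : Group NilGroup :=
  Group.ofLeftAxioms
    (fun a b c => by ext <;> simp only [mul_def] <;> ring)
    (fun a => by ext <;> simp only [mul_def, one_def] <;> ring)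
    (fun a => by ext <;> simp only [mul_def, one_def, inv_def] <;> ring)

/-- The matrix realization of `Nil`, with the usual matrix multiplication. -/
def toMatrix : NilGroup →* Matrix (Fin 3) (Fin 3) ℝ where
  toFun g := !![1, g.x, g.z; 0, 1, g.y; 0, 0, 1]
  map_one' := by
    ext i j
    fin_cases i <;> fin_cases j <;> simp [one_def]
  map_mul' g h := by
    ext i j
    fin_cases i <;> fin_cases j <;>
      simp [mul_def, Matrix.mul_apply, Fin.sum_univ_three] <;> ring

/-- The basis `e₁, e₂, e₃` of the Lie algebra of `Nil` (indexed by `0, 1, 2`), regarded as complex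
matrices. -/
noncomputable def lieBasis : Fin 3 → Matrix (Fin 3) (Fin 3) ℂ :=
  ![!![0, 1, 0; 0, 0, 0; 0, 0, 0],
    !![0, 0, 0; 0, 0, 1; 0, 0, 0],
    !![0, 0, 1; 0, 0, 0; 0, 0, 0]]

/-- The global chart `(x, y, z)` of `Nil`. -/
def coords (g : NilGroup) : Fin 3 → ℝ := ![g.x, g.y, g.z]

/-- The Riemannian metric `dx² + dy² + (dz - x dy)²`, evaluated at the point with coordinates `p`
on tangent vectors with components `u`, `v`. -/
def metric (p u v : Fin 3 → ℝ) : ℝ :=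
  u 0 * v 0 + u 1 * v 1 + (u 2 - p 0 * u 1) * (v 2 - p 0 * v 1)

/-- The components `g_{ij}` of the metric in the chart `(x, y, z)`. -/
def gram (p : Fin 3 → ℝ) : Matrix (Fin 3) (Fin 3) ℝ :=
  Matrix.of fun i j => metric p (Pi.single i 1) (Pi.single j 1)

/-- The partial derivative `∂_i g_{jl}` at `p`. -/
noncomputable def gramDeriv (p : Fin 3 → ℝ) (i j l : Fin 3) : ℝ :=
  fderiv ℝ (fun q => gram q j l) p (Pi.single i 1)

/-- The Christoffel symbols `Γ^k_{ij}` of the Levi-Civita connection in the chart `(x, y, z)`. -/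
noncomputable def christoffel (p : Fin 3 → ℝ) (k i j : Fin 3) : ℝ :=
  1 / 2 * ∑ l, (gram p)⁻¹ k l * (gramDeriv p i j l + gramDeriv p j i l - gramDeriv p l i j)

/-! ### Geometry of a local parametrization

`F : ℂ → (Fin 3 → ℝ)` gives the coordinates in `Nil` of a map of the parameter `w = u + iv`. -/

/-- The two coordinate directions of the parameter plane. -/
noncomputable def dir : Fin 2 → ℂ := ![1, Complex.I]

/-- The coordinate tangent vectors: `∂F/∂u` for `a = 0` and `∂F/∂v` for `a = 1`. -/
noncomputable def tangent (F : ℂ → Fin 3 → ℝ) (a : Fin 2) (w : ℂ) : Fin 3 → ℝ :=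
  fderiv ℝ F w (dir a)

/-- The covariant derivative `∇_{∂_a F} ∂_b F` in `Nil`. -/
noncomputable def covDeriv (F : ℂ → Fin 3 → ℝ) (a b : Fin 2) (w : ℂ) : Fin 3 → ℝ := fun k =>
  fderiv ℝ (tangent F b) w (dir a) k +
    ∑ i, ∑ j, christoffel (F w) k i j * tangent F a w i * tangent F b w j

/-- The first fundamental form. -/
noncomputable def firstForm (F : ℂ → Fin 3 → ℝ) (w : ℂ) : Matrix (Fin 2) (Fin 2) ℝ :=
  Matrix.of fun a b => metric (F w) (tangent F a w) (tangent F b w)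

/-- The second fundamental form in the direction of the normal vector `N`. -/
noncomputable def secondForm (F : ℂ → Fin 3 → ℝ) (w : ℂ) (N : Fin 3 → ℝ) :
    Matrix (Fin 2) (Fin 2) ℝ :=
  Matrix.of fun a b => metric (F w) (covDeriv F a b w) N

/-- `N` is a unit normal vector of the surface at the point with parameter `w`. -/
def IsUnitNormal (F : ℂ → Fin 3 → ℝ) (w : ℂ) (N : Fin 3 → ℝ) : Prop :=
  metric (F w) N N = 1 ∧ ∀ a, metric (F w) (tangent F a w) N = 0

/-- The mean curvature `H` with respect to the unit normal `N`: half the trace of the shape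
operator. -/
noncomputable def meanCurvature (F : ℂ → Fin 3 → ℝ) (w : ℂ) (N : Fin 3 → ℝ) : ℝ :=
  1 / 2 * ((firstForm F w)⁻¹ * secondForm F w N).trace

/-! ### Surfaces in Nil -/

section Surface

variable {M : Type*} [TopologicalSpace M] [ChartedSpace ℂ M]

/-- `f` is a `C²` immersion of the surface `M` into `Nil`. Here `M` is a real two-dimensional
manifold, modelled on `ℂ` as a real vector space. -/
structure IsImmersion (f : M → NilGroup) : Prop where
  contMDiff : ContMDiff 𝓘(ℝ, ℂ) 𝓘(ℝ, Fin 3 → ℝ) 2 (fun p => coords (f p))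
  injective : ∀ p : M,
    Function.Injective (mfderiv 𝓘(ℝ, ℂ) 𝓘(ℝ, Fin 3 → ℝ) (fun p => coords (f p)) p)

/-- The local coordinate expression of `f` in the chart `φ` of `M` and the chart `(x, y, z)`. -/
noncomputable def localRep (f : M → NilGroup) (φ : OpenPartialHomeomorph M ℂ) : ℂ → Fin 3 → ℝ :=
  fun w => coords (f (φ.symm w))

/-- `f` is minimal: its mean curvature vanishes identically (for either choice of the unit
normal, computed in arbitrary `C²` charts). -/
def IsMinimal (f : M → NilGroup) : Prop :=
  ∀ φ ∈ IsManifold.maximalAtlas 𝓘(ℝ, ℂ) 2 M, ∀ w ∈ φ.target, ∀ N,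
    IsUnitNormal (localRep f φ) w N → meanCurvature (localRep f φ) w N = 0

/-- The chart `φ` is a conformal parameter for `f`: the induced metric is
`exp (2α) (du² + dv²)` in it. -/
def IsConformalParameter (f : M → NilGroup) (φ : OpenPartialHomeomorph M ℂ) : Prop :=
  φ ∈ IsManifold.maximalAtlas 𝓘(ℝ, ℂ) 2 M ∧
    ∃ α : ℂ → ℝ, ∀ w ∈ φ.target,
      firstForm (localRep f φ) w = Real.exp (2 * α w) • (1 : Matrix (Fin 2) (Fin 2) ℝ)

/-- The Wirtinger derivative `∂ = (∂_u - i ∂_v) / 2`. -/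
noncomputable def dz (h : ℂ → ℂ) (w : ℂ) : ℂ :=
  1 / 2 * (fderiv ℝ h w 1 - Complex.I * fderiv ℝ h w Complex.I)

/-- The Wirtinger derivative `∂̄ = (∂_u + i ∂_v) / 2`. -/
noncomputable def dzbar (h : ℂ → ℂ) (w : ℂ) : ℂ :=
  1 / 2 * (fderiv ℝ h w 1 + Complex.I * fderiv ℝ h w Complex.I)

/-- The left translation `Ψ = f⁻¹ ∂f` of `∂f` to the complexified Lie algebra, for a map `g` from
the parameter domain to `Nil`. -/
noncomputable def leftLogDeriv (g : ℂ → NilGroup) (w : ℂ) : Matrix (Fin 3) (Fin 3) ℂ :=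
  (toMatrix (g w)⁻¹).map Complex.ofReal *
    Matrix.of fun i j => dz (fun ζ => (toMatrix (g ζ) i j : ℂ)) w

/-- `(ψ₁, ψ₂)` is a generating spinor of the surface `f` in the parameter `φ`: it is continuous and
`f⁻¹ ∂f = Z₁ e₁ + Z₂ e₂ + Z₃ e₃` with
`Z₁ = (i/2) (ψ̄₂² + ψ₁²)`, `Z₂ = (1/2) (ψ̄₂² - ψ₁²)`, `Z₃ = ψ₁ ψ̄₂`. -/
structure IsGeneratingSpinor (f : M → NilGroup) (φ : OpenPartialHomeomorph M ℂ)
    (ψ₁ ψ₂ : ℂ → ℂ) : Prop where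
  continuousOn_fst : ContinuousOn ψ₁ φ.target
  continuousOn_snd : ContinuousOn ψ₂ φ.target
  leftLogDeriv_eq : ∀ w ∈ φ.target,
    leftLogDeriv (fun ζ => f (φ.symm ζ)) w =
      (Complex.I / 2 * (star (ψ₂ w) ^ 2 + ψ₁ w ^ 2)) • lieBasis 0 +
        (1 / 2 * (star (ψ₂ w) ^ 2 - ψ₁ w ^ 2)) • lieBasis 1 +
        (ψ₁ w * star (ψ₂ w)) • lieBasis 2

end Surface

end NilGroup

namespace NilGroup

/-! In a conformal parameter, minimality is harmonicity: `T = ∇_u F_u + ∇_v F_v` vanishes.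
Conformality makes `T` orthogonal to the tangent plane, and `H = 0` makes it orthogonal to the
normal (`covDeriv_add_covDeriv_eq_zero`).

Written for the left invariant components `Z_k` of `f⁻¹ ∂f`, harmonicity together with the symmetry
of second derivatives expresses each `∂̄ Z_k` as a quadratic form in `Z` and its conjugate
(`dzbar_mcForm`).

Put `a = ψ₁` and `b = ψ̄₂`. The functions `a²`, `b²`, `ab` are linear combinations of the `Z_k`, so
they are differentiable with known `∂̄`. An immersion has no common zero of `a` and `b`; where one
of them is nonzero it is a continuous square root, hence differentiable, and division gives the
other (`differentiableAt_and_dzbar_of_ne_zero`). -/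

theorem gram_eq (p : Fin 3 → ℝ) :
    gram p = !![1, 0, 0; 0, 1 + p 0 ^ 2, -p 0; 0, -p 0, 1] := by
  ext i j
  fin_cases i <;> fin_cases j <;> simp [gram, metric, Pi.single_apply]; ring

theorem gram_inv (p : Fin 3 → ℝ) :
    (gram p)⁻¹ = !![1, 0, 0; 0, 1, p 0; 0, p 0, 1 + p 0 ^ 2] := by
  refine Matrix.inv_eq_left_inv ?_
  rw [gram_eq]
  ext i j
  fin_cases i <;> fin_cases j <;> simp [Matrix.mul_apply, Fin.sum_univ_three] <;> ring

theorem gramDeriv_eq (p : Fin 3 → ℝ) (i j l : Fin 3) :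
    gramDeriv p i j l =
      (Pi.single 0 1 : Fin 3 → ℝ) i * !![0, 0, 0; 0, 2 * p 0, -1; 0, -1, 0] j l := by
  have h0 : HasFDerivAt (fun q : Fin 3 → ℝ => q 0)
      (ContinuousLinearMap.proj (R := ℝ) (φ := fun _ : Fin 3 => ℝ) 0) p := hasFDerivAt_apply 0 p
  have h : HasFDerivAt (fun q : Fin 3 → ℝ => gram q j l)
      ((!![0, 0, 0; 0, 2 * p 0, -1; 0, -1, 0] : Matrix (Fin 3) (Fin 3) ℝ) j l •
        ContinuousLinearMap.proj (R := ℝ) (φ := fun _ : Fin 3 => ℝ) 0) p := by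
    simp only [gram_eq]
    have h1 : HasFDerivAt (fun q : Fin 3 → ℝ => 1 + q 0 ^ 2)
        ((2 * p 0) • ContinuousLinearMap.proj (R := ℝ) (φ := fun _ : Fin 3 => ℝ) 0) p := by
      simpa using (h0.pow 2).const_add 1
    have h2 : HasFDerivAt (fun q : Fin 3 → ℝ => -q 0)
        ((-1 : ℝ) • ContinuousLinearMap.proj (R := ℝ) (φ := fun _ : Fin 3 => ℝ) 0) p :=
      h0.neg.congr_fderiv (by ext; simp)
    fin_cases j <;> fin_cases l <;> simp [hasFDerivAt_const, h1] <;> exact h2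
  rw [gramDeriv, h.fderiv]
  fin_cases i <;> simp

/-- Contracting once and for all keeps inverse matrices and derivatives of the metric out of the
later computations. -/
theorem sum_christoffel (p u v : Fin 3 → ℝ) (k : Fin 3) :
    ∑ i, ∑ j, christoffel p k i j * u i * v j =
      ![-p 0 * u 1 * v 1 + (u 1 * v 2 + u 2 * v 1) / 2,
        p 0 / 2 * (u 0 * v 1 + u 1 * v 0) - (u 0 * v 2 + u 2 * v 0) / 2,
        (p 0 ^ 2 - 1) / 2 * (u 0 * v 1 + u 1 * v 0) - p 0 / 2 * (u 0 * v 2 + u 2 * v 0)] k := by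
  simp only [christoffel, gram_inv, gramDeriv_eq, Fin.sum_univ_three]
  fin_cases k <;> simp <;> ring

/-- The components `(dx, dy, dz - x dy)` of the vector `v` at `p` in the left invariant frame. -/
def frame (p v : Fin 3 → ℝ) : Fin 3 → ℝ := ![v 0, v 1, v 2 - p 0 * v 1]

/-- With `c = a × b`, the triple product expansion gives `t × c = 0`, and Lagrange's identity then
reads `0 = |t|² |c|²` with `|c|² = r²`. -/
theorem eq_zero_of_orthogonal {a b t : Fin 3 → ℝ} {r : ℝ} (hr : 0 < r)
    (haa : a ⬝ᵥ a = r) (hbb : b ⬝ᵥ b = r) (hab : a ⬝ᵥ b = 0)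
    (hta : t ⬝ᵥ a = 0) (htb : t ⬝ᵥ b = 0) (htc : t ⬝ᵥ crossProduct a b = 0) : t = 0 := by
  have h : crossProduct a b ⬝ᵥ crossProduct a b = r ^ 2 := by
    rw [cross_dot_cross, haa, hbb, hab]; ring
  have hx : crossProduct t (crossProduct a b) = 0 := by
    rw [cross_cross_eq_smul_sub_smul', htb, dotProduct_comm, hta]
    simp
  have key := cross_dot_cross t (crossProduct a b) t (crossProduct a b)
  rw [hx, h, htc, zero_dotProduct, zero_mul, sub_zero] at key
  exact dotProduct_self_eq_zero.1 ((mul_eq_zero.1 key.symm).resolve_right (by positivity))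

theorem metric_eq_dotProduct (p u v : Fin 3 → ℝ) : metric p u v = frame p u ⬝ᵥ frame p v := by
  simp [metric, frame, dotProduct, Fin.sum_univ_three]

/-! ### Second derivatives, the Levi-Civita connection and harmonicity -/

section SecondOrder

variable {F : ℂ → Fin 3 → ℝ} {w : ℂ}

theorem hasFDerivAt_tangent (hF : ContDiffAt ℝ 2 F w) (b : Fin 2) :
    HasFDerivAt (tangent F b) ((fderiv ℝ (fderiv ℝ F) w).flip (dir b)) w := by
  have h : DifferentiableAt ℝ (fderiv ℝ F) w :=
    (hF.fderiv_right (m := 1) (by norm_num)).differentiableAt (by norm_num)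
  exact (ContinuousLinearMap.apply ℝ (Fin 3 → ℝ) (dir b)).hasFDerivAt.comp w h.hasFDerivAt

theorem fderiv_tangent_comm (hF : ContDiffAt ℝ 2 F w) (a b : Fin 2) :
    fderiv ℝ (tangent F b) w (dir a) = fderiv ℝ (tangent F a) w (dir b) := by
  rw [(hasFDerivAt_tangent hF a).fderiv, (hasFDerivAt_tangent hF b).fderiv]
  exact hF.isSymmSndFDerivAt (by simp) (dir a) (dir b)

theorem differentiableAt_tangent_apply (hF : ContDiffAt ℝ 2 F w) (b : Fin 2) (k : Fin 3) :
    DifferentiableAt ℝ (fun ζ => tangent F b ζ k) w :=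
  differentiableAt_pi.1 (hasFDerivAt_tangent hF b).differentiableAt k

theorem fderiv_tangent_apply (hF : ContDiffAt ℝ 2 F w) (b : Fin 2) (k : Fin 3) (v : ℂ) :
    fderiv ℝ (fun ζ => tangent F b ζ k) w v = fderiv ℝ (tangent F b) w v k := by
  rw [fderiv_apply (hasFDerivAt_tangent hF b).differentiableAt]
  rfl

theorem differentiableAt_coord (hF : ContDiffAt ℝ 2 F w) (k : Fin 3) :
    DifferentiableAt ℝ (fun ζ => F ζ k) w :=
  differentiableAt_pi.1 (hF.differentiableAt (by norm_num)) k

theorem fderiv_coord (hF : ContDiffAt ℝ 2 F w) (a : Fin 2) (k : Fin 3) :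
    fderiv ℝ (fun ζ => F ζ k) w (dir a) = tangent F a w k := by
  rw [fderiv_apply (hF.differentiableAt (by norm_num))]
  rfl

/-- The connection is torsion-free: second derivatives and Christoffel symbols are both symmetric.
-/
theorem covDeriv_comm (hF : ContDiffAt ℝ 2 F w) (a b : Fin 2) :
    covDeriv F a b w = covDeriv F b a w := by
  ext k
  simp only [covDeriv, sum_christoffel, fderiv_tangent_comm hF a b]
  fin_cases k <;> simp <;> ring

/-- The Levi-Civita connection is metric. -/
theorem fderiv_metric_tangent (hF : ContDiffAt ℝ 2 F w) (a b c : Fin 2) :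
    fderiv ℝ (fun ζ => metric (F ζ) (tangent F b ζ) (tangent F c ζ)) w (dir a) =
      metric (F w) (covDeriv F a b w) (tangent F c w) +
        metric (F w) (covDeriv F a c w) (tangent F b w) := by
  have hT := fun b k => (differentiableAt_tangent_apply hF b k).hasFDerivAt
  have h0 := (differentiableAt_coord hF 0).hasFDerivAt
  have h := (((hT b 0).fun_mul (hT c 0)).fun_add ((hT b 1).fun_mul (hT c 1))).fun_add
    (((hT b 2).fun_sub (h0.fun_mul (hT b 1))).fun_mul ((hT c 2).fun_sub (h0.fun_mul (hT c 1))))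
  simp only [metric]
  rw [h.fderiv]
  simp only [add_apply, sub_apply,
    smul_apply, fderiv_tangent_apply hF, fderiv_coord hF, covDeriv,
    sum_christoffel, smul_eq_mul, Matrix.cons_val]
  ring

/-- The derivative of the left invariant components of `∂_b F` in the direction `∂_a`. -/
theorem fderiv_frame (hF : ContDiffAt ℝ 2 F w) (b : Fin 2) (k : Fin 3) :
    DifferentiableAt ℝ (fun ζ => frame (F ζ) (tangent F b ζ) k) w ∧
    ∀ a, fderiv ℝ (fun ζ => frame (F ζ) (tangent F b ζ) k) w (dir a) =
      frame (F w) (fderiv ℝ (tangent F b) w (dir a)) k -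
        (Pi.single 2 (tangent F a w 0 * tangent F b w 1) : Fin 3 → ℝ) k := by
  have hT := fun b k => (differentiableAt_tangent_apply hF b k).hasFDerivAt
  have h0 := (differentiableAt_coord hF 0).hasFDerivAt
  have h := (hT b 2).fun_sub (h0.fun_mul (hT b 1))
  fin_cases k
  · exact ⟨(hT b 0).differentiableAt, fun a => by simp [frame, fderiv_tangent_apply hF]⟩
  · exact ⟨(hT b 1).differentiableAt, fun a => by simp [frame, fderiv_tangent_apply hF]⟩
  · refine ⟨h.differentiableAt, fun a => ?_⟩
    refine (congrArg (fun L => L (dir a)) h.fderiv).trans ?_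
    simp [frame, fderiv_tangent_apply hF, fderiv_coord hF]
    ring

theorem metric_add_left (p u v n : Fin 3 → ℝ) :
    metric p (u + v) n = metric p u n + metric p v n := by
  simp only [metric, Pi.add_apply]; ring

/-- A conformally parametrized minimal surface is harmonic. -/
theorem covDeriv_add_covDeriv_eq_zero {U : Set ℂ} (hU : IsOpen U) (hw : w ∈ U)
    (hF : ContDiffAt ℝ 2 F w) {α : ℂ → ℝ}
    (hα : ∀ ζ ∈ U, firstForm F ζ = Real.exp (2 * α ζ) • (1 : Matrix (Fin 2) (Fin 2) ℝ))
    (hmin : ∀ N, IsUnitNormal F w N → meanCurvature F w N = 0) :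
    covDeriv F 0 0 w + covDeriv F 1 1 w = 0 := by
  have hm : ∀ ζ ∈ U, ∀ b c, metric (F ζ) (tangent F b ζ) (tangent F c ζ) =
      Real.exp (2 * α ζ) * (1 : Matrix (Fin 2) (Fin 2) ℝ) b c := fun ζ hζ b c => by
    simpa [firstForm] using congrFun (congrFun (hα ζ hζ) b) c
  have hUw := hU.mem_nhds hw
  -- Only the identities `|F_u|² = |F_v|²` and `⟨F_u, F_v⟩ = 0` are differentiated, never `α`, so no
  -- regularity of `α` is needed.
  have e1 : ∀ a, fderiv ℝ (fun ζ => metric (F ζ) (tangent F 0 ζ) (tangent F 0 ζ)) w (dir a) =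
      fderiv ℝ (fun ζ => metric (F ζ) (tangent F 1 ζ) (tangent F 1 ζ)) w (dir a) := fun a => by
    rw [Filter.EventuallyEq.fderiv_eq]
    filter_upwards [hUw] with ζ hζ
    simp [hm ζ hζ]
  have e2 : ∀ a, fderiv ℝ (fun ζ => metric (F ζ) (tangent F 0 ζ) (tangent F 1 ζ)) w (dir a) =
      0 := fun a => by
    rw [Filter.EventuallyEq.fderiv_eq (f := fun _ => (0 : ℝ))]
    · simp
    filter_upwards [hUw] with ζ hζ
    simp [hm ζ hζ]
  simp only [fderiv_metric_tangent hF] at e1 e2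
  have hc := covDeriv_comm hF 0 1
  set T := covDeriv F 0 0 w + covDeriv F 1 1 w with hT
  -- `⟨∇_u F_u, F_u⟩ = ⟨∇_u F_v, F_v⟩ = ⟨∇_v F_u, F_v⟩ = -⟨∇_v F_v, F_u⟩`.
  have t0 : metric (F w) T (tangent F 0 w) = 0 := by
    have h1 := e1 0; have h2 := e2 1
    rw [hc] at h1
    rw [hT, metric_add_left]
    linarith
  have t1 : metric (F w) T (tangent F 1 w) = 0 := by
    have h1 := e1 1; have h2 := e2 0
    rw [hc] at h2
    rw [hT, metric_add_left]
    linarith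
  set r := Real.exp (2 * α w) with hr
  have hr0 : 0 < r := Real.exp_pos _
  have m00 : metric (F w) (tangent F 0 w) (tangent F 0 w) = r := by simp [hm w hw, hr]
  have m11 : metric (F w) (tangent F 1 w) (tangent F 1 w) = r := by simp [hm w hw, hr]
  have m01 : metric (F w) (tangent F 0 w) (tangent F 1 w) = 0 := by simp [hm w hw]
  rw [metric_eq_dotProduct] at t0 t1 m00 m11 m01
  set A := frame (F w) (tangent F 0 w) with hA
  set B := frame (F w) (tangent F 1 w) with hB
  set C := crossProduct A B with hC
  -- The cross product is taken in the orthonormal frame, where it has length `r`; the term `F w 0 *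
  -- C 1` converts frame components back to coordinates.
  set N : Fin 3 → ℝ := r⁻¹ • ![C 0, C 1, C 2 + F w 0 * C 1] with hN
  have hNf : frame (F w) N = r⁻¹ • C := by
    ext k; fin_cases k <;> simp [frame, hN]; ring
  have hNu : IsUnitNormal F w N := by
    refine ⟨?_, fun a => ?_⟩
    · rw [metric_eq_dotProduct, hNf, smul_dotProduct, dotProduct_smul, hC, cross_dot_cross,
        m00, m11, m01]
      simp only [smul_eq_mul]
      field_simp
      ring
    · rw [metric_eq_dotProduct, hNf, dotProduct_smul]
      fin_cases a
      · simp [← hA, hC]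
      · simp [← hB, hC]
  have hH := hmin N hNu
  rw [meanCurvature, hα w hw, ← hr,
    Matrix.inv_eq_left_inv (B := r⁻¹ • (1 : Matrix (Fin 2) (Fin 2) ℝ))
      (by rw [smul_mul_smul_comm, inv_mul_cancel₀ hr0.ne', one_smul, one_mul])] at hH
  -- Since the first form is `r` times the identity, `H` is `⟨T, N⟩ / (2r)`.
  have tN : metric (F w) T N = 0 := by
    rw [hT, metric_add_left]
    simpa [secondForm, Matrix.trace_fin_two, hr0.ne', ← mul_add] using hH
  have tC : frame (F w) T ⬝ᵥ C = 0 := by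
    rw [metric_eq_dotProduct, hNf, dotProduct_smul] at tN
    simpa [hr0.ne'] using tN
  have h := eq_zero_of_orthogonal hr0 m00 m11 m01 t0 t1 tC
  have h0 := congrFun h 0; have h1 := congrFun h 1; have h2 := congrFun h 2
  simp only [frame, Matrix.cons_val, Pi.zero_apply] at h0 h1 h2
  ext k
  fin_cases k
  · exact h0
  · exact h1
  · simpa [h1] using h2

end SecondOrder

/-! ### Wirtinger calculus and continuous square roots -/

section Wirtinger

variable {a b : ℂ → ℂ} {w : ℂ}

theorem dzbar_fun_mul (ha : DifferentiableAt ℝ a w) (hb : DifferentiableAt ℝ b w) :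
    dzbar (fun ζ => a ζ * b ζ) w = a w * dzbar b w + dzbar a w * b w := by
  simp only [dzbar, fderiv_fun_mul ha hb, add_apply, smul_apply, smul_eq_mul]
  ring

theorem dzbar_linearCombination (c d : ℂ) (ha : DifferentiableAt ℝ a w)
    (hb : DifferentiableAt ℝ b w) :
    dzbar (fun ζ => c * a ζ + d * b ζ) w = c * dzbar a w + d * dzbar b w := by
  have h := (ha.hasFDerivAt.const_mul c).fun_add (hb.hasFDerivAt.const_mul d)
  simp only [dzbar, h.fderiv, add_apply, smul_apply, smul_eq_mul]
  ring

theorem dzbar_congr (h : a =ᶠ[nhds w] b) : dzbar a w = dzbar b w := by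
  simp only [dzbar, h.fderiv_eq]

theorem dz_star : dz (fun ζ => star (a ζ)) w = star (dzbar a w) := by
  have h : ∀ v, fderiv ℝ (fun ζ => star (a ζ)) w v = star (fderiv ℝ a w v) := fun v => by
    rw [fderiv_star]
    rfl
  simp only [dz, dzbar, h]
  simp
  ring

theorem fderiv_ofReal {x : ℂ → ℝ} (hx : DifferentiableAt ℝ x w) (v : ℂ) :
    fderiv ℝ (fun ζ => (x ζ : ℂ)) w v = (fderiv ℝ x w v : ℂ) := by
  have h : HasFDerivAt (fun ζ => (x ζ : ℂ)) (Complex.ofRealCLM.comp (fderiv ℝ x w)) w :=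
    Complex.ofRealCLM.hasFDerivAt.comp w hx.hasFDerivAt
  rw [h.fderiv]
  rfl

/-- A continuous branch of the square root of a differentiable function is differentiable away from
its zeros. -/
theorem differentiableAt_of_sq (hb : ContinuousAt b w) (hbw : b w ≠ 0)
    (h : DifferentiableAt ℝ (fun ζ => b ζ ^ 2) w) : DifferentiableAt ℝ b w := by
  have hs : HasStrictDerivAt (fun x : ℂ => x ^ 2) (2 * b w) (b w) := by
    simpa using hasStrictDerivAt_pow 2 (b w)
  have hne : 2 * b w ≠ 0 := mul_ne_zero two_ne_zero hbw
  have hinv := hs.to_localInverse hne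
  have hd : DifferentiableAt ℝ (fun ζ => hs.localInverse _ _ _ hne (b ζ ^ 2)) w :=
    (hinv.hasDerivAt.differentiableAt.restrictScalars ℝ).comp (f := fun ζ => b ζ ^ 2) w h
  refine hd.congr_of_eventuallyEq ?_
  have hl := HasStrictFDerivAt.eventually_left_inverse (hs.hasStrictFDerivAt_equiv hne)
  -- Continuity keeps `b ζ` near `b w`, where the local inverse undoes squaring; this selects the
  -- branch.
  filter_upwards [hb.eventually hl] with ζ hζ
  exact hζ.symm

/-- Here `b` is a square root of `b²` and `a = (ab) / b` near `w`; the product rule for `b²` and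
then for `ab` yields both equations after cancelling `b w`. The conclusions are symmetric in `a` and
`b`, so the lemma serves whichever spinor component is nonzero. -/
theorem differentiableAt_and_dzbar_of_ne_zero (hb : ContinuousAt b w) (hbw : b w ≠ 0)
    (h2 : DifferentiableAt ℝ (fun ζ => b ζ ^ 2) w)
    (h1 : DifferentiableAt ℝ (fun ζ => a ζ * b ζ) w) {D : ℂ}
    (e2 : dzbar (fun ζ => b ζ ^ 2) w = Complex.I / 2 * D * (star (a w) * b w))
    (e1 : dzbar (fun ζ => a ζ * b ζ) w =
      Complex.I / 4 * D * (a w * star (a w) + b w * star (b w))) :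
    DifferentiableAt ℝ a w ∧ DifferentiableAt ℝ b w ∧
      dzbar a w = Complex.I / 4 * D * star (b w) ∧
      dzbar b w = Complex.I / 4 * D * star (a w) := by
  have db := differentiableAt_of_sq hb hbw h2
  have da : DifferentiableAt ℝ a w := by
    refine (h1.mul (db.inv hbw)).congr_of_eventuallyEq ?_
    filter_upwards [hb.eventually_ne hbw] with ζ hζ
    simp [hζ]
  have eb : dzbar b w = Complex.I / 4 * D * star (a w) := by
    simp only [sq] at e2
    rw [dzbar_fun_mul db db] at e2
    apply mul_left_cancel₀ hbw
    linear_combination e2 / 2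
  refine ⟨da, db, ?_, eb⟩
  rw [dzbar_fun_mul da db, eb] at e1
  apply mul_left_cancel₀ hbw
  linear_combination e1

end Wirtinger

/-! ### The form `F⁻¹ ∂F` and its structure equations -/

section MaurerCartan

variable {F : ℂ → Fin 3 → ℝ} {w : ℂ}

/-- The components of `F⁻¹ ∂F` in the left invariant frame. -/
noncomputable def mcForm (F : ℂ → Fin 3 → ℝ) (k : Fin 3) (ζ : ℂ) : ℂ :=
  ((frame (F ζ) (tangent F 0 ζ) k : ℂ) - Complex.I * frame (F ζ) (tangent F 1 ζ) k) / 2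

theorem leftLogDeriv_eq_mcForm {g : ℂ → NilGroup}
    (hg : DifferentiableAt ℝ (fun ζ => coords (g ζ)) w) :
    leftLogDeriv g w 0 1 = mcForm (fun ζ => coords (g ζ)) 0 w ∧
    leftLogDeriv g w 1 2 = mcForm (fun ζ => coords (g ζ)) 1 w ∧
    leftLogDeriv g w 0 2 = mcForm (fun ζ => coords (g ζ)) 2 w := by
  have hx : DifferentiableAt ℝ (fun ζ => (g ζ).x) w := differentiableAt_pi.1 hg 0
  have hy : DifferentiableAt ℝ (fun ζ => (g ζ).y) w := differentiableAt_pi.1 hg 1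
  have hz : DifferentiableAt ℝ (fun ζ => (g ζ).z) w := differentiableAt_pi.1 hg 2
  have ht : ∀ v k, fderiv ℝ (fun ζ => coords (g ζ)) w v k =
      fderiv ℝ (fun ζ => coords (g ζ) k) w v := fun v k => by
    rw [fderiv_apply hg]
    rfl
  have cx : ∀ h : NilGroup, coords h 0 = h.x := fun h => rfl
  have cy : ∀ h : NilGroup, coords h 1 = h.y := fun h => rfl
  have cz : ∀ h : NilGroup, coords h 2 = h.z := fun h => rfl
  refine ⟨?_, ?_, ?_⟩ <;>
    simp [leftLogDeriv, toMatrix, Matrix.mul_apply, Fin.sum_univ_three, dz, inv_def, mcForm, frame,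
      tangent, dir, ht, fderiv_ofReal hx, fderiv_ofReal hy, fderiv_ofReal hz, cx, cy, cz] <;> ring

/-- The real part of `∂̄ Z_k` is a divergence, governed by harmonicity; the imaginary part is a
curl, governed by the symmetry of second derivatives. -/
theorem differentiableAt_mcForm (hF : ContDiffAt ℝ 2 F w) (k : Fin 3) :
    DifferentiableAt ℝ (mcForm F k) w ∧
    dzbar (mcForm F k) w =
      (((fderiv ℝ (fun ζ => frame (F ζ) (tangent F 0 ζ) k) w (dir 0) +
        fderiv ℝ (fun ζ => frame (F ζ) (tangent F 1 ζ) k) w (dir 1) : ℝ) : ℂ) +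
      Complex.I * ((fderiv ℝ (fun ζ => frame (F ζ) (tangent F 0 ζ) k) w (dir 1) -
        fderiv ℝ (fun ζ => frame (F ζ) (tangent F 1 ζ) k) w (dir 0) : ℝ) : ℂ)) / 4 := by
  have h0 := (fderiv_frame hF 0 k).1
  have h1 := (fderiv_frame hF 1 k).1
  have d0 : DifferentiableAt ℝ (fun ζ => (frame (F ζ) (tangent F 0 ζ) k : ℂ)) w :=
    Complex.ofRealCLM.differentiableAt.comp w h0
  have d1 : DifferentiableAt ℝ (fun ζ => (frame (F ζ) (tangent F 1 ζ) k : ℂ)) w :=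
    Complex.ofRealCLM.differentiableAt.comp w h1
  have e : mcForm F k = fun ζ => 1 / 2 * (frame (F ζ) (tangent F 0 ζ) k : ℂ) +
      -(Complex.I / 2) * (frame (F ζ) (tangent F 1 ζ) k : ℂ) := by
    ext ζ; rw [mcForm]; ring
  rw [e]
  refine ⟨(d0.const_mul _).add (d1.const_mul _), ?_⟩
  rw [dzbar_linearCombination _ _ d0 d1]
  simp only [dzbar, fderiv_ofReal h0, fderiv_ofReal h1, dir, Matrix.cons_val]
  push_cast
  linear_combination (-1 / 4 * (fderiv ℝ (fun ζ => frame (F ζ) (tangent F 1 ζ) k) w Complex.I : ℂ))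
    * Complex.I_sq

/-- The structure equations of `Nil` and harmonicity, in terms of `F⁻¹ ∂F`. -/
theorem dzbar_mcForm (hF : ContDiffAt ℝ 2 F w)
    (hT : covDeriv F 0 0 w + covDeriv F 1 1 w = 0) :
    dzbar (mcForm F 0) w =
      -1 / 2 * (star (mcForm F 1 w) * mcForm F 2 w + star (mcForm F 2 w) * mcForm F 1 w) ∧
    dzbar (mcForm F 1) w =
      1 / 2 * (star (mcForm F 0 w) * mcForm F 2 w + star (mcForm F 2 w) * mcForm F 0 w) ∧
    dzbar (mcForm F 2) w =
      -1 / 2 * (star (mcForm F 0 w) * mcForm F 1 w - star (mcForm F 1 w) * mcForm F 0 w) := by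
  have hs := fderiv_tangent_comm hF 0 1
  have t0 := congrFun hT 0; have t1 := congrFun hT 1; have t2 := congrFun hT 2
  simp only [Pi.add_apply, covDeriv, sum_christoffel, Matrix.cons_val, Pi.zero_apply] at t0 t1 t2
  refine ⟨?_, ?_, ?_⟩
  all_goals
    rw [(differentiableAt_mcForm hF _).2]
    simp only [(fderiv_frame hF _ _).2]
    simp only [hs, mcForm, frame, Matrix.cons_val]
    apply Complex.ext
    all_goals
      simp
  -- Real parts follow from the components of `T = 0`; imaginary parts are identities once `hs` has
  -- identified the mixed derivatives.
  · linear_combination t0 / 4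
  · ring
  · linear_combination t1 / 4
  · ring
  -- The third frame component of `T` is `T₂ - x T₁`.
  · linear_combination t2 / 4 - F w 0 * t1 / 4
  · ring

end MaurerCartan

/-! ### Passage from the surface to its local representation -/

section Surface

variable {M : Type*} [TopologicalSpace M]

theorem contDiffAt_localRep [ChartedSpace ℂ M] [IsManifold 𝓘(ℝ, ℂ) 2 M] {f : M → NilGroup} (hf : IsImmersion f)
    {φ : OpenPartialHomeomorph M ℂ} (hφ : φ ∈ IsManifold.maximalAtlas 𝓘(ℝ, ℂ) 2 M) {w : ℂ}
    (hw : w ∈ φ.target) : ContDiffAt ℝ 2 (localRep f φ) w := by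
  have h : ContMDiffOn 𝓘(ℝ, ℂ) 𝓘(ℝ, Fin 3 → ℝ) 2 (localRep f φ) φ.target :=
    hf.contMDiff.comp_contMDiffOn (contMDiffOn_symm_of_mem_maximalAtlas hφ)
  exact (contMDiffOn_iff_contDiffOn.1 h).contDiffAt (φ.open_target.mem_nhds hw)

theorem IsGeneratingSpinor.mcForm_eq {f : M → NilGroup} {φ : OpenPartialHomeomorph M ℂ}
    {ψ₁ ψ₂ : ℂ → ℂ} (hψ : IsGeneratingSpinor f φ ψ₁ ψ₂) {w : ℂ} (hw : w ∈ φ.target)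
    (hF : DifferentiableAt ℝ (localRep f φ) w) :
    mcForm (localRep f φ) 0 w = Complex.I / 2 * (star (ψ₂ w) ^ 2 + ψ₁ w ^ 2) ∧
    mcForm (localRep f φ) 1 w = 1 / 2 * (star (ψ₂ w) ^ 2 - ψ₁ w ^ 2) ∧
    mcForm (localRep f φ) 2 w = ψ₁ w * star (ψ₂ w) := by
  obtain ⟨h0, h1, h2⟩ := leftLogDeriv_eq_mcForm (g := fun ζ => f (φ.symm ζ)) hF
  rw [hψ.leftLogDeriv_eq w hw] at h0 h1 h2
  refine ⟨h0.symm.trans ?_, h1.symm.trans ?_, h2.symm.trans ?_⟩ <;> simp [lieBasis]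

end Surface

/-- The real part of `Z_k` is half the corresponding frame component of `F_u`. This is what excludes
a common zero of `ψ₁` and `ψ₂`. -/
theorem mcForm_ne_zero {F : ℂ → Fin 3 → ℝ} {w : ℂ}
    (h : metric (F w) (tangent F 0 w) (tangent F 0 w) ≠ 0) : ∃ k, mcForm F k w ≠ 0 := by
  by_contra! hz
  apply h
  have h0 : frame (F w) (tangent F 0 w) = 0 := by
    ext k
    simpa [mcForm] using congrArg Complex.re (hz k)
  simp [metric_eq_dotProduct, h0]

end NilGroup

theorem mainTheorem12 {M : Type*} [TopologicalSpace M] [ChartedSpace ℂ M]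
    [IsManifold 𝓘(ℝ, ℂ) 2 M] (f : M → NilGroup)
    (hf : NilGroup.IsImmersion f) (hmin : NilGroup.IsMinimal f)
    (φ : OpenPartialHomeomorph M ℂ) (hφ : NilGroup.IsConformalParameter f φ)
    (ψ₁ ψ₂ : ℂ → ℂ) (hψ : NilGroup.IsGeneratingSpinor f φ ψ₁ ψ₂) :
    ∀ w ∈ φ.target,
      DifferentiableAt ℝ ψ₁ w ∧ DifferentiableAt ℝ ψ₂ w ∧
      NilGroup.dzbar ψ₁ w =
        Complex.I / 4 * ((‖ψ₂ w‖ ^ 2 - ‖ψ₁ w‖ ^ 2 : ℝ) : ℂ) * ψ₂ w ∧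
      NilGroup.dz ψ₂ w =
        -(Complex.I / 4) * ((‖ψ₂ w‖ ^ 2 - ‖ψ₁ w‖ ^ 2 : ℝ) : ℂ) * ψ₁ w := by
  open NilGroup in
  intro w hw
  obtain ⟨hφm, α, hα⟩ := hφ
  have hF : ∀ ζ ∈ φ.target, ContDiffAt ℝ 2 (localRep f φ) ζ :=
    fun ζ hζ => contDiffAt_localRep hf hφm hζ
  have hZ := fun ζ hζ => hψ.mcForm_eq hζ ((hF ζ hζ).differentiableAt (by norm_num))
  have hT := covDeriv_add_covDeriv_eq_zero φ.open_target hw (hF w hw) hα (hmin φ hφm w hw)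
  obtain ⟨q0, q1, q2⟩ := dzbar_mcForm (hF w hw) hT
  have d := fun k => (differentiableAt_mcForm (hF w hw) k).1
  obtain ⟨k, hk⟩ := mcForm_ne_zero (F := localRep f φ) (w := w) (by
    have := congrFun (congrFun (hα w hw) 0) 0
    simp only [firstForm, Matrix.of_apply] at this
    simp [this])
  obtain ⟨z0, z1, z2⟩ := hZ w hw
  simp only [z0, z1, z2] at q0 q1 q2
  have hU := φ.open_target.mem_nhds hw
  have ca : ContinuousAt ψ₁ w := hψ.continuousOn_fst.continuousAt hU
  have cb : ContinuousAt (fun ζ => star (ψ₂ ζ)) w := (hψ.continuousOn_snd.continuousAt hU).star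
  -- Inverting the spinor formulas: `ψ₁² = -i Z₁ - Z₂` and `ψ̄₂² = -i Z₁ + Z₂`.
  have ea : (fun ζ => ψ₁ ζ ^ 2) =ᶠ[nhds w]
      fun ζ => -Complex.I * mcForm (localRep f φ) 0 ζ + -1 * mcForm (localRep f φ) 1 ζ := by
    filter_upwards [hU] with ζ hζ
    rw [(hZ ζ hζ).1, (hZ ζ hζ).2.1]
    linear_combination (1 / 2 * (star (ψ₂ ζ) ^ 2 + ψ₁ ζ ^ 2)) * Complex.I_sq
  have eb : (fun ζ => star (ψ₂ ζ) ^ 2) =ᶠ[nhds w]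
      fun ζ => -Complex.I * mcForm (localRep f φ) 0 ζ + 1 * mcForm (localRep f φ) 1 ζ := by
    filter_upwards [hU] with ζ hζ
    rw [(hZ ζ hζ).1, (hZ ζ hζ).2.1]
    linear_combination (1 / 2 * (star (ψ₂ ζ) ^ 2 + ψ₁ ζ ^ 2)) * Complex.I_sq
  have eab : (fun ζ => ψ₁ ζ * star (ψ₂ ζ)) =ᶠ[nhds w] mcForm (localRep f φ) 2 := by
    filter_upwards [hU] with ζ hζ
    rw [(hZ ζ hζ).2.2]
  have da := (((d 0).const_mul (-Complex.I)).add ((d 1).const_mul (-1))).congr_of_eventuallyEq ea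
  have db := (((d 0).const_mul (-Complex.I)).add ((d 1).const_mul 1)).congr_of_eventuallyEq eb
  have dab := (d 2).congr_of_eventuallyEq eab
  set D : ℂ := ((‖ψ₂ w‖ ^ 2 - ‖ψ₁ w‖ ^ 2 : ℝ) : ℂ) with hD
  have hD' : D = ψ₂ w * star (ψ₂ w) - ψ₁ w * star (ψ₁ w) := by
    simp [hD, Complex.mul_conj, Complex.normSq_eq_norm_sq]
  simp only [star_mul', star_add, star_sub, star_pow, star_div₀, star_one,
    star_ofNat, Complex.star_def, Complex.conj_I, Complex.conj_conj] at q0 q1 q2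
  have fa : dzbar (fun ζ => ψ₁ ζ ^ 2) w =
      Complex.I / 2 * D * (star (star (ψ₂ w)) * ψ₁ w) := by
    rw [dzbar_congr ea, dzbar_linearCombination _ _ (d 0) (d 1), q0, q1, hD']
    simp only [Complex.star_def, Complex.conj_conj]
    ring
  have fb : dzbar (fun ζ => star (ψ₂ ζ) ^ 2) w =
      Complex.I / 2 * D * (star (ψ₁ w) * star (ψ₂ w)) := by
    rw [dzbar_congr eb, dzbar_linearCombination _ _ (d 0) (d 1), q0, q1, hD']
    simp only [Complex.star_def]
    ring
  have fab : dzbar (fun ζ => ψ₁ ζ * star (ψ₂ ζ)) w = Complex.I / 4 * D *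
      (ψ₁ w * star (ψ₁ w) + star (ψ₂ w) * star (star (ψ₂ w))) := by
    rw [dzbar_congr eab, q2, hD']
    simp only [Complex.star_def, Complex.conj_conj]
    ring
  have main : DifferentiableAt ℝ ψ₁ w ∧ DifferentiableAt ℝ (fun ζ => star (ψ₂ ζ)) w ∧
      dzbar ψ₁ w = Complex.I / 4 * D * star (star (ψ₂ w)) ∧
      dzbar (fun ζ => star (ψ₂ ζ)) w = Complex.I / 4 * D * star (ψ₁ w) := by
    by_cases hb : star (ψ₂ w) = 0
    · have ha : ψ₁ w ≠ 0 := by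
        rintro ha
        apply hk
        fin_cases k <;> simp [z0, z1, z2, ha, hb, -star_eq_zero, -Complex.star_def]
      have hc : (fun ζ => ψ₁ ζ * star (ψ₂ ζ)) = fun ζ => star (ψ₂ ζ) * ψ₁ ζ := by
        ext ζ; exact mul_comm _ _
      rw [hc] at dab fab
      obtain ⟨h1, h2, h3, h4⟩ := differentiableAt_and_dzbar_of_ne_zero ca ha da dab fa
        (fab.trans (by ring))
      exact ⟨h2, h1, h4, h3⟩
    · exact differentiableAt_and_dzbar_of_ne_zero cb hb db dab fb fab
  obtain ⟨h1, h2, h3, h4⟩ := main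
  refine ⟨h1, by simpa using h2.star, by simpa using h3, ?_⟩
  -- The second equation is the conjugate of the one for `∂̄ ψ̄₂`; the sign changes because `D` is
  -- real and `i` is not.
  have h5 := dz_star (a := fun ζ => star (ψ₂ ζ)) (w := w)
  simp only [star_star] at h5
  rw [h5, h4, hD]
  simp
  ring
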